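/- Let $n\ge 1$ and write $\langle X,Y\rangle=\operatorname{tr}(X^{\top}Y)$, $SO(n)=\{R\in\mathbb R^{n\times n}: R^\top R=I,\ \det R=1\}$, and $\operatorname{co}(SO(n))$ for its convex hull in $\mathbb R^{n\times n}$. Put $\sigma=\begin{bmatrix}1&0\\0&-1\end{bmatrix}$, $J=\begin{bmatrix}0&-1\\1&0\end{bmatrix}$, $I_2=\begin{bmatrix}1&0\\0&1\end{bmatrix}$ and, for $1\le i\le n$, $$\lambda_i=\sigma^{\otimes(i-1)}\otimes J\otimes I_2^{\otimes(n-i)},\qquad \rho_i=I_2^{\otimes(i-1)}\otimes J\otimes\sigma^{\otimes(n-i)},\qquad P_{\rm even}=\frac12\begin{bmatrix}I+\sigma^{\otimes(n-1)}\\ I-\sigma^{\otimes(n-1)}\end{bmatrix}\in\mathbb R^{2^n\times 2^{n-1}},$$ and $A_{ij}=-P_{\rm even}^{\top}\lambda_i\rho_jP_{\rm even}\in\mathbb R^{2^{n-1}\times2^{n-1}}$ for $1\le i,j\le n$. Let $\mathcal A(Z)\in\mathbb R^{n\times n}$ be the matrix with entries $\mathcal A(Z)_{ij}=\langle A_{ij},Z\rangle$,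 and let $\mathcal A^\dagger(D)=\sum_{i,j}D_{ij}A_{ij}$ for $D\in\mathbb R^{n\times n}$. For every $D\in\mathbb R^{n\times n}$ the matrix $\mathcal A^\dagger(D)$ is symmetric, and $\langle\mathcal A(Z),D\rangle=\langle Z,\mathcal A^\dagger(D)\rangle$ for all symmetric $Z$, so that $\mathcal A^\dagger$ is the adjoint of $\mathcal A$. Let $\nu$ be the largest eigenvalue of $\mathcal A^\dagger(D)$, and consider the problem $$\max_{R\in\operatorname{co}(SO(n))}\langle D,R\rangle .$$ (a) For every unit eigenvector $\mu$ of $\mathcal A^\dagger(D)$ with eigenvalue $\nu$, the matrix $R^*=\mathcal A(\mu\mu^\top)$ lies in $\operatorname{co}(SO(n))$ and is an optimal solution. (b) If $\nu$ has multiplicity $1$, then $R^*=\mathcal A(\mu\mu^\top)$ lies in $SO(n)$ and is the unique optimal solution. If $n\le 3$, then $\mathcal A(\mu\mu^\top)\in SO(n)$ for every $\mu$ as in (a), whatever the multiplicity of $\nu$. (c) In every case there is a $\mu$ as in (a) with $\mathcal A(\mu\mu^\top)\in SO(n)$, and every optimal solution $R^*\in SO(n)$ is of the form $R^*=\mathcal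 A(\mu\mu^\top)$ with some $\mu$ as in (a). -/

import Mathlib

/-- The Frobenius inner product `⟨A, B⟩ = trace (Aᵀ B)` of real matrices. -/
def frobIP {ι κ : Type*} [Fintype ι] [Fintype κ] (A B : Matrix ι κ ℝ) : ℝ :=
  (A.transpose * B).trace

/-- The iterated Kronecker product `M 0 ⊗ M 1 ⊗ ⋯ ⊗ M (n - 1)` of `2 × 2` matrices, a
`2 ^ n × 2 ^ n` matrix. Rows and columns are indexed by the multi-indices `Fin n → Fin 2`
(in lexicographic order these are the usual row and column numbers). For `n = 0` it is the
`1 × 1` identity matrix. -/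
def kronProd {n : ℕ} (M : Fin n → Matrix (Fin 2) (Fin 2) ℝ) :
    Matrix (Fin n → Fin 2) (Fin n → Fin 2) ℝ :=
  Matrix.of fun x y => ∏ k, M k (x k) (y k)

/-- The matrix `diag(1, -1)`. -/
def sigZ : Matrix (Fin 2) (Fin 2) ℝ := !![1, 0; 0, -1]

/-- The rotation by a right angle. -/
def rotJ : Matrix (Fin 2) (Fin 2) ℝ := !![0, -1; 1, 0]

/-- `λᵢ = diag(1,-1) ⊗ ⋯ ⊗ diag(1,-1) ⊗ J ⊗ I ⊗ ⋯ ⊗ I`, with `J` in place `i`. -/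
def lamMat (n : ℕ) (i : Fin n) : Matrix (Fin n → Fin 2) (Fin n → Fin 2) ℝ :=
  kronProd fun k => if k < i then sigZ else if k = i then rotJ else 1

/-- `ρᵢ = I ⊗ ⋯ ⊗ I ⊗ J ⊗ diag(1,-1) ⊗ ⋯ ⊗ diag(1,-1)`, with `J` in place `i`. -/
def rhoMat (n : ℕ) (i : Fin n) : Matrix (Fin n → Fin 2) (Fin n → Fin 2) ℝ :=
  kronProd fun k => if k < i then 1 else if k = i then rotJ else sigZ

/-- For `n = m + 1`, the `2 ^ n × 2 ^ (n - 1)` matrix `P_even`: one half of the matrix with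
upper block `I + diag(1,-1) ⊗ ⋯ ⊗ diag(1,-1)` and lower block
`I - diag(1,-1) ⊗ ⋯ ⊗ diag(1,-1)`, with `n - 1` factors in each product. The first entry of the
row multi-index selects the block, the remaining entries the row inside the block. -/
noncomputable def pEven (m : ℕ) : Matrix (Fin (m + 1) → Fin 2) (Fin m → Fin 2) ℝ :=
  Matrix.of fun x y =>
    (1 / 2 : ℝ) *
      (if x 0 = 0 then (1 + kronProd (n := m) fun _ => sigZ) (Fin.tail x) y
        else (1 - kronProd (n := m) fun _ => sigZ) (Fin.tail x) y)

/-- For `n = m + 1`, the `2 ^ (n - 1) × 2 ^ (n - 1)` matrix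
`A i j = - P_evenᵀ λᵢ ρⱼ P_even`. -/
noncomputable def aMat (m : ℕ) (i j : Fin (m + 1)) :
    Matrix (Fin m → Fin 2) (Fin m → Fin 2) ℝ :=
  -((pEven m).transpose * lamMat (m + 1) i * rhoMat (m + 1) j * pEven m)

/-- The map `𝒜`, for `n = m + 1`: `𝒜 Z` is the `n × n` matrix with entries `⟨A i j, Z⟩`. -/
noncomputable def calA (m : ℕ) (Z : Matrix (Fin m → Fin 2) (Fin m → Fin 2) ℝ) :
    Matrix (Fin (m + 1)) (Fin (m + 1)) ℝ :=
  Matrix.of fun i j => frobIP (aMat m i j) Z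

/-- The adjoint of `𝒜`, for `n = m + 1`: `𝒜† D = ∑ i j, D i j • A i j`. -/
noncomputable def calAdj (m : ℕ) (D : Matrix (Fin (m + 1)) (Fin (m + 1)) ℝ) :
    Matrix (Fin m → Fin 2) (Fin m → Fin 2) ℝ :=
  ∑ i, ∑ j, D i j • aMat m i j

/-- The convex hull of `SO(n)` in the space of real `n × n` matrices. -/
def coSO (n : ℕ) : Set (Matrix (Fin n) (Fin n) ℝ) :=
  convexHull ℝ (Matrix.specialOrthogonalGroup (Fin n) ℝ : Set (Matrix (Fin n) (Fin n) ℝ))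

/-- `R` is an optimal solution of the problem of maximizing `⟨D, R⟩` over the convex hull of
`SO(n)`. -/
def IsOptimal {n : ℕ} (D R : Matrix (Fin n) (Fin n) ℝ) : Prop :=
  R ∈ coSO n ∧ ∀ S ∈ coSO n, frobIP D S ≤ frobIP D R

/-- `ν` is the largest (real) eigenvalue of the square matrix `M`. -/
def IsLargestEigenvalue {ι : Type*} [Fintype ι] [DecidableEq ι] (M : Matrix ι ι ℝ) (ν : ℝ) :
    Prop :=
  IsGreatest {x : ℝ | Module.End.HasEigenvalue (Matrix.toLin' M) x} ν

/-- `μ` is an eigenvector of `M` for `ν`, of Euclidean norm one. -/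
def IsUnitEigenvector {ι : Type*} [Fintype ι] (M : Matrix ι ι ℝ) (ν : ℝ) (μ : ι → ℝ) : Prop :=
  M.mulVec μ = ν • μ ∧ dotProduct μ μ = 1

/-! The `lamMat n i` and the `rhoMat n j` are two mutually commuting Clifford families on spinors,
and `pEven` embeds isometrically onto the even ones. Skewness of λ turns 𝒜(μμᵀ) into the quadratic
map x ↦ (⟨λᵢx, ρⱼx⟩) at x = P_even μ (`calA_vecMulVec`). By Cartan–Dieudonné, rotations lift to
products of Clifford vectors (`IsCliffordFamily.exists_lift`); these lifts are orthogonal, preserve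
evenness, and realise left and right multiplication of this matrix by rotations.

Two facts follow. The vacuum vector maps to the identity, so every rotation is some 𝒜(μμᵀ).
Conversely, a singular value decomposition with rotation factors reduces an even unit spinor to one
with diagonal image; that image averages the sign matrices of even multi-indices, all of determinant
1, so 𝒜(μμᵀ) lies in the convex hull (`calA_vecMulVec_mem_coSO`).

Since the Rayleigh quotient of 𝒜†(D) at μ is ⟨D, 𝒜(μμᵀ)⟩, its maximum over unit vectors equals the
maximum of ⟨D, ·⟩ over SO(n), and rotations attaining it come from top eigenvectors. A simple
eigenvalue leaves only ±μ, hence one maximising rotation. For n ≤ 3 every unit spinor gives a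
rotation, by explicit formulas. -/

theorem kronProd_mul {n : ℕ} (M N : Fin n → Matrix (Fin 2) (Fin 2) ℝ) :
    kronProd M * kronProd N = kronProd fun k => M k * N k := by
  ext x z
  simp only [kronProd, Matrix.mul_apply, Matrix.of_apply, ← Finset.prod_mul_distrib]
  rw [Finset.prod_univ_sum, Fintype.piFinset_univ]

theorem kronProd_transpose {n : ℕ} (M : Fin n → Matrix (Fin 2) (Fin 2) ℝ) :
    (kronProd M).transpose = kronProd fun k => (M k).transpose := rfl

theorem kronProd_smul {n : ℕ} (c : Fin n → ℝ) (M : Fin n → Matrix (Fin 2) (Fin 2) ℝ) :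
    (kronProd fun k => c k • M k) = (∏ k, c k) • kronProd M := by
  ext x z
  simp [kronProd, Finset.prod_mul_distrib]

theorem kronProd_diagonal {n : ℕ} (d : Fin n → Fin 2 → ℝ) :
    (kronProd fun k => Matrix.diagonal (d k)) = Matrix.diagonal fun x => ∏ k, d k (x k) := by
  ext x z
  by_cases h : x = z
  · subst h; simp [kronProd]
  · obtain ⟨k, hk⟩ := Function.ne_iff.mp h
    rw [Matrix.diagonal_apply_ne _ h]
    exact Finset.prod_eq_zero (Finset.mem_univ k) (Matrix.diagonal_apply_ne _ hk)

theorem kronProd_one {n : ℕ} : (kronProd fun _ : Fin n => (1 : Matrix (Fin 2) (Fin 2) ℝ)) = 1 := by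
  have := kronProd_diagonal (n := n) fun _ _ => 1
  simpa using this

/-- If the factors commute up to scalars, so do the Kronecker products. -/
theorem kronProd_mul_comm {n : ℕ} (c : Fin n → ℝ) (M N : Fin n → Matrix (Fin 2) (Fin 2) ℝ)
    (h : ∀ k, M k * N k = c k • (N k * M k)) :
    kronProd M * kronProd N = (∏ k, c k) • (kronProd N * kronProd M) := by
  rw [kronProd_mul, kronProd_mul, ← kronProd_smul]
  simp only [h]

/-- The sign vector of `diag(1, -1)`. -/
def bitSign (b : Fin 2) : ℝ := if b = 0 then 1 else -1

theorem bitSign_mul_self (b : Fin 2) : bitSign b * bitSign b = 1 := by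
  unfold bitSign; split <;> norm_num

theorem sigZ_eq_diagonal : sigZ = Matrix.diagonal bitSign := by
  ext i j; fin_cases i <;> fin_cases j <;> simp [sigZ, bitSign]

theorem sigZ_mul_sigZ : sigZ * sigZ = 1 := by
  ext i j; fin_cases i <;> fin_cases j <;> simp [sigZ]

theorem rotJ_mul_rotJ : rotJ * rotJ = -1 := by
  ext i j; fin_cases i <;> fin_cases j <;> simp [rotJ]

theorem sigZ_mul_rotJ : sigZ * rotJ = -(rotJ * sigZ) := by
  ext i j; fin_cases i <;> fin_cases j <;> simp [rotJ, sigZ]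

theorem sigZ_transpose : sigZ.transpose = sigZ := by
  ext i j; fin_cases i <;> fin_cases j <;> simp [sigZ]

theorem rotJ_transpose : rotJ.transpose = -rotJ := by
  ext i j; fin_cases i <;> fin_cases j <;> simp [rotJ]

/-- A family of anticommuting skew-symmetric complex structures. -/
structure IsCliffordFamily {ι : Type*} [Fintype ι] [DecidableEq ι] {n : ℕ}
    (γ : Fin n → Matrix ι ι ℝ) : Prop where
  transpose : ∀ i, (γ i).transpose = -γ i
  sq : ∀ i, γ i * γ i = -1
  anticomm : ∀ i j, i ≠ j → γ i * γ j = -(γ j * γ i)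

/-- The chirality matrix `diag(1,-1) ⊗ ⋯ ⊗ diag(1,-1)`. -/
def chirality (n : ℕ) : Matrix (Fin n → Fin 2) (Fin n → Fin 2) ℝ := kronProd fun _ => sigZ

theorem chirality_eq_diagonal (n : ℕ) :
    chirality n = Matrix.diagonal fun x => ∏ k, bitSign (x k) := by
  simp only [chirality, sigZ_eq_diagonal, kronProd_diagonal]

/-- Puts a global minus sign into a single tensor factor, so that signed identities can be checked
factor by factor. -/
theorem prod_neg_one_at {n : ℕ} (i : Fin n) : ∏ k, (if k = i then (-1 : ℝ) else 1) = -1 := by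
  simp

/-! ### The two Clifford families and the chirality -/

/-- For i < j all tensor factors commute except at place i, where J meets σ and yields the sign. In
the ρ family this place is j. -/
theorem isCliffordFamily_lamMat (n : ℕ) : IsCliffordFamily (lamMat n) := by
  have key : ∀ i j : Fin n, i < j → lamMat n i * lamMat n j = -(lamMat n j * lamMat n i) := by
    intro i j hij
    rw [lamMat, lamMat, kronProd_mul_comm (fun k => if k = i then -1 else 1), prod_neg_one_at,
      neg_one_smul]
    intro k
    rcases lt_trichotomy k i with h | rfl | h
    · simp [h, h.trans hij, h.ne]
    · simp [hij, sigZ_mul_rotJ]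
    · simp [h.ne', h.not_gt]
  refine ⟨fun i => ?_, fun i => ?_, fun i j hij => ?_⟩
  · rw [← neg_one_smul ℝ, ← prod_neg_one_at i, lamMat, ← kronProd_smul, kronProd_transpose]
    congr 1; ext1 k
    rcases lt_trichotomy k i with h | rfl | h
    · simp [h, h.ne, sigZ_transpose]
    · simp [rotJ_transpose]
    · simp [h.ne', h.not_gt]
  · rw [lamMat, kronProd_mul, ← neg_one_smul ℝ, ← prod_neg_one_at i, ← kronProd_one,
      ← kronProd_smul]
    congr 1; ext1 k
    rcases lt_trichotomy k i with h | rfl | h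
    · simp [h, h.ne, sigZ_mul_sigZ]
    · simp [rotJ_mul_rotJ]
    · simp [h.ne', h.not_gt]
  · rcases lt_or_gt_of_ne hij with h | h
    · exact key i j h
    · rw [key j i h, neg_neg]

theorem isCliffordFamily_rhoMat (n : ℕ) : IsCliffordFamily (rhoMat n) := by
  have key : ∀ i j : Fin n, i < j → rhoMat n i * rhoMat n j = -(rhoMat n j * rhoMat n i) := by
    intro i j hij
    rw [rhoMat, rhoMat, kronProd_mul_comm (fun k => if k = j then -1 else 1), prod_neg_one_at,
      neg_one_smul]
    intro k
    rcases lt_trichotomy k j with h | rfl | h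
    · simp [h, h.ne]
    · simp [hij.ne', hij.not_gt, sigZ_mul_rotJ]
    · simp [h.ne', h.not_gt, (hij.trans h).ne', (hij.trans h).not_gt]
  refine ⟨fun i => ?_, fun i => ?_, fun i j hij => ?_⟩
  · rw [← neg_one_smul ℝ, ← prod_neg_one_at i, rhoMat, ← kronProd_smul, kronProd_transpose]
    congr 1; ext1 k
    rcases lt_trichotomy k i with h | rfl | h
    · simp [h, h.ne]
    · simp [rotJ_transpose]
    · simp [h.ne', h.not_gt, sigZ_transpose]
  · rw [rhoMat, kronProd_mul, ← neg_one_smul ℝ, ← prod_neg_one_at i, ← kronProd_one,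
      ← kronProd_smul]
    congr 1; ext1 k
    rcases lt_trichotomy k i with h | rfl | h
    · simp [h, h.ne]
    · simp [rotJ_mul_rotJ]
    · simp [h.ne', h.not_gt, sigZ_mul_sigZ]
  · rcases lt_or_gt_of_ne hij with h | h
    · exact key i j h
    · rw [key j i h, neg_neg]

/-- For i ≤ j all factors commute. For j < i, exactly the factors at places i and j anticommute and
the two signs cancel. -/
theorem lamMat_mul_rhoMat_comm (n : ℕ) (i j : Fin n) :
    lamMat n i * rhoMat n j = rhoMat n j * lamMat n i := by
  rcases le_or_gt i j with hij | hij
  · rw [lamMat, rhoMat, kronProd_mul_comm (fun _ => 1)]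
    · simp
    · intro k
      rcases lt_trichotomy k i with h | rfl | h
      · simp [h, h.trans_le hij]
      · rcases hij.eq_or_lt with rfl | h'
        · simp
        · simp [h']
      · simp [h.ne', h.not_gt]
  · rw [lamMat, rhoMat,
      kronProd_mul_comm (fun k => (if k = i then -1 else 1) * (if k = j then -1 else 1)),
      Finset.prod_mul_distrib, prod_neg_one_at, prod_neg_one_at]
    · simp
    · intro k
      rcases lt_trichotomy k j with h | rfl | h
      · simp [h, h.ne, h.trans hij, (h.trans hij).ne]
      · simp [hij, hij.ne, sigZ_mul_rotJ]
      · rcases lt_trichotomy k i with h' | rfl | h'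
        · simp [h.not_gt, h.ne', h', h'.ne]
        · simp [h.not_gt, h.ne', sigZ_mul_rotJ]
        · simp [h'.not_gt, h'.ne', h.ne']

theorem chirality_mul_lamMat (n : ℕ) (i : Fin n) :
    chirality n * lamMat n i = -(lamMat n i * chirality n) := by
  rw [lamMat, chirality, kronProd_mul_comm (fun k => if k = i then -1 else 1), prod_neg_one_at,
    neg_one_smul]
  intro k
  rcases lt_trichotomy k i with h | rfl | h
  · simp [h, h.ne]
  · simp [sigZ_mul_rotJ]
  · simp [h.ne', h.not_gt]

theorem chirality_mul_rhoMat (n : ℕ) (i : Fin n) :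
    chirality n * rhoMat n i = -(rhoMat n i * chirality n) := by
  rw [rhoMat, chirality, kronProd_mul_comm (fun k => if k = i then -1 else 1), prod_neg_one_at,
    neg_one_smul]
  intro k
  rcases lt_trichotomy k i with h | rfl | h
  · simp [h, h.ne]
  · simp [sigZ_mul_rotJ]
  · simp [h.ne', h.not_gt]

/-- This makes the diagonal of `spinQuad` readable on even spinors, where the chirality acts
trivially. -/
theorem lamMat_mul_rhoMat_self (n : ℕ) (i : Fin n) :
    lamMat n i * rhoMat n i =
      -((Matrix.diagonal fun x : Fin n → Fin 2 => bitSign (x i)) * chirality n) := by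
  have h1 : (Matrix.diagonal fun x : Fin n → Fin 2 => bitSign (x i)) =
      kronProd fun k => if k = i then sigZ else 1 := by
    have := kronProd_diagonal (n := n) fun k => if k = i then bitSign else fun _ => 1
    simp only [apply_ite Matrix.diagonal, ← sigZ_eq_diagonal, Matrix.diagonal_one] at this
    rw [this]
    congr 1; ext1 x
    rw [Finset.prod_eq_single i]
    · simp
    · intro b _ hb; simp [hb]
    · simp
  rw [h1, chirality, kronProd_mul, lamMat, rhoMat, kronProd_mul, ← neg_one_smul ℝ,
    ← prod_neg_one_at i, ← kronProd_smul]
  congr 1; ext1 k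
  rcases lt_trichotomy k i with h | rfl | h
  · simp [h, h.ne]
  · simp [rotJ_mul_rotJ, sigZ_mul_sigZ]
  · simp [h.ne', h.not_gt]

/-- Left and right Clifford multiplication agree on the unit of the Clifford algebra. -/
theorem lamMat_mulVec_single (n : ℕ) (i : Fin n) :
    (lamMat n i).mulVec (Pi.single 0 1) = (rhoMat n i).mulVec (Pi.single 0 1) := by
  ext x
  simp only [Matrix.mulVec_single_one, Matrix.col_apply, lamMat, rhoMat, kronProd, Matrix.of_apply]
  refine Finset.prod_congr rfl fun k _ => ?_
  rw [Pi.zero_apply]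
  have h0 : ∀ a : Fin 2, sigZ a 0 = (1 : Matrix (Fin 2) (Fin 2) ℝ) a 0 := by
    intro a; fin_cases a <;> simp [sigZ, Matrix.one_apply]
  rcases lt_trichotomy k i with h | rfl | h
  · simp [h, h0]
  · simp
  · simp [h.ne', h.not_gt, h0]

theorem chirality_mulVec_single (n : ℕ) :
    (chirality n).mulVec (Pi.single 0 1) = Pi.single 0 1 := by
  rw [chirality_eq_diagonal, Matrix.diagonal_mulVec_single]
  simp [bitSign]

/-! ### Even spinors -/

/-- The coefficient is 1 for even x and 0 for odd x: each y has exactly one even extension by a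
leading bit, and `pEven` sends its basis vector there. -/
theorem pEven_apply (m : ℕ) (x : Fin (m + 1) → Fin 2) (y : Fin m → Fin 2) :
    pEven m x y = if Fin.tail x = y then (1 + ∏ k, bitSign (x k)) / 2 else 0 := by
  have hS : (kronProd fun _ : Fin m => sigZ) = chirality m := rfl
  have ht : ∏ k : Fin m, bitSign (x k.succ) = ∏ k, bitSign (Fin.tail x k) := rfl
  have hs : bitSign (x 0) = if x 0 = 0 then 1 else -1 := rfl
  rw [Fin.prod_univ_succ, ht, hs]
  simp only [pEven, Matrix.of_apply, hS, chirality_eq_diagonal, Matrix.add_apply, Matrix.sub_apply,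
    Matrix.one_apply, Matrix.diagonal_apply]
  by_cases h : Fin.tail x = y <;> by_cases h0 : x 0 = 0 <;> simp only [h, h0, if_true, if_false] <;>
    ring

theorem prod_bitSign_sq {n : ℕ} (x : Fin n → Fin 2) :
    (∏ k, bitSign (x k)) * ∏ k, bitSign (x k) = 1 := by
  rw [← Finset.prod_mul_distrib]; simp [bitSign_mul_self]

theorem pEven_transpose_mul_self (m : ℕ) : (pEven m).transpose * pEven m = 1 := by
  ext y z
  rw [Matrix.mul_apply, ← (Fin.consEquiv fun _ => Fin 2).sum_comp, Fintype.sum_prod_type,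
    Fin.sum_univ_two, ← Finset.sum_add_distrib]
  have hp := prod_bitSign_sq y
  simp only [Matrix.transpose_apply, pEven_apply, Fin.consEquiv, Equiv.coe_fn_mk, Fin.tail_cons,
    Fin.prod_univ_succ, Fin.cons_zero, Fin.cons_succ]
  rw [Finset.sum_eq_single y]
  · by_cases h : y = z
    · subst h
      simp [bitSign]
      simp only [bitSign] at hp
      linear_combination (1 / 2) * hp
    · simp [h]
  · intro b _ hb; simp [hb]
  · simp

theorem pEven_mul_transpose (m : ℕ) :
    pEven m * (pEven m).transpose = (1 / 2 : ℝ) • (1 + chirality (m + 1)) := by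
  ext x z
  rw [Matrix.mul_apply]
  simp only [Matrix.transpose_apply, pEven_apply, chirality_eq_diagonal]
  rw [Finset.sum_eq_single (Fin.tail x)]
  · by_cases h : x = z
    · subst h
      simp
      linear_combination (1 / 4) * prod_bitSign_sq x
    · rw [if_pos rfl]
      simp [h]
      intro ht
      -- Distinct multi-indices with equal tails differ in the first bit, so they have opposite
      -- parity and one of the two coefficients vanishes.
      by_cases h0 : x 0 = z 0
      · exact absurd (by rw [← Fin.cons_self_tail x, ← Fin.cons_self_tail z, h0, ht]) h
      · have hs : ∏ k, bitSign (z k) = - ∏ k, bitSign (x k) := by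
          rw [Fin.prod_univ_succ, Fin.prod_univ_succ]
          have : ∀ k : Fin m, z k.succ = x k.succ := fun k => congrFun ht k
          simp only [this]
          have : bitSign (z 0) = - bitSign (x 0) := by
            generalize z 0 = a at *; generalize x 0 = b at *
            fin_cases a <;> fin_cases b <;> simp [bitSign] at *
          rw [this]; ring
        have hx := prod_bitSign_sq x
        have : (1 + ∏ k, bitSign (x k)) * (1 + ∏ k, bitSign (z k)) = 0 := by
          rw [hs]; linear_combination -hx
        rcases mul_eq_zero.mp this with h | h
        · left; exact h
        · right; exact h
  · intro b _ hb; simp [hb.symm]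
  · simp

/-! ### Reflections and the Cartan–Dieudonné theorem -/

open Matrix in
/-- The Householder reflection `1 - 2 v vᵀ` in a unit vector `v`. -/
def householder {n : ℕ} (v : Fin n → ℝ) : Matrix (Fin n) (Fin n) ℝ := 1 - (2 : ℝ) • vecMulVec v v

open Matrix in
theorem householder_transpose {n : ℕ} (v : Fin n → ℝ) :
    (householder v).transpose = householder v := by
  simp [householder, transpose_vecMulVec]

open Matrix in
theorem householder_mulVec {n : ℕ} (v w : Fin n → ℝ) :
    (householder v).mulVec w = w - (2 * (v ⬝ᵥ w)) • v := by
  rw [householder, sub_mulVec, one_mulVec, smul_mulVec, vecMulVec_mulVec]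
  simp [smul_smul]

open Matrix in
theorem householder_mul_self {n : ℕ} {v : Fin n → ℝ} (hv : v ⬝ᵥ v = 1) :
    householder v * householder v = 1 := by
  rw [householder, mul_sub, sub_mul, sub_mul, smul_mul_smul_comm, vecMulVec_mul_vecMulVec, hv]
  simp only [one_mul, mul_one, one_smul]
  module

open Matrix in
theorem householder_mem_orthogonalGroup {n : ℕ} {v : Fin n → ℝ} (hv : v ⬝ᵥ v = 1) :
    householder v ∈ orthogonalGroup (Fin n) ℝ := by
  rw [mem_orthogonalGroup_iff, householder_transpose, householder_mul_self hv]

open Matrix in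
theorem det_householder {n : ℕ} {v : Fin n → ℝ} (hv : v ⬝ᵥ v = 1) : (householder v).det = -1 := by
  have : householder v =
      1 + replicateCol Unit ((-2 : ℝ) • v) * replicateRow Unit v := by
    rw [← vecMulVec_eq, smul_vecMulVec, householder]; module
  rw [this, det_one_add_replicateCol_mul_replicateRow, dotProduct_smul, hv]
  norm_num

open Matrix in
theorem orthogonal_transpose_mul {n : ℕ} {U : Matrix (Fin n) (Fin n) ℝ}
    (hU : U ∈ orthogonalGroup (Fin n) ℝ) : U.transpose * U = 1 :=
  (mem_orthogonalGroup_iff' (Fin n) ℝ).mp hU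

open Matrix in
theorem orthogonal_mul_transpose {n : ℕ} {U : Matrix (Fin n) (Fin n) ℝ}
    (hU : U ∈ orthogonalGroup (Fin n) ℝ) : U * U.transpose = 1 :=
  (mem_orthogonalGroup_iff (Fin n) ℝ).mp hU

open Matrix in
/-- Induction over the orthogonal group, based on the Cartan–Dieudonné theorem. -/
theorem orthogonalGroup_induction {n : ℕ} {P : Matrix (Fin n) (Fin n) ℝ → Prop} (one : P 1)
    (mul : ∀ v : Fin n → ℝ, v ⬝ᵥ v = 1 → ∀ U ∈ orthogonalGroup (Fin n) ℝ, P U →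
      P (householder v * U))
    {U : Matrix (Fin n) (Fin n) ℝ} (hU : U ∈ orthogonalGroup (Fin n) ℝ) : P U := by
  have key : ∀ l : List (EuclideanSpace ℝ (Fin n)), ∀ U ∈ orthogonalGroup (Fin n) ℝ,
      (∀ x : EuclideanSpace ℝ (Fin n), WithLp.toLp 2 (U.mulVec x.ofLp) =
        (l.map fun v => (Submodule.span ℝ {v})ᗮ.reflection).prod x) → P U := by
    intro l
    induction l with
    | nil =>
      intro U _ h
      have : U = 1 := by
        apply Matrix.ext_of_mulVec_single
        intro i
        rw [one_mulVec]
        exact congrArg WithLp.ofLp (h (WithLp.toLp 2 (Pi.single i 1)))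
      rwa [this]
    | cons v l ih =>
      intro U hU h
      simp only [List.map_cons, List.prod_cons] at h
      -- A zero vector in the list contributes the identity; otherwise normalise it and cancel its
      -- reflection against the first factor of U.
      rcases eq_or_ne v 0 with rfl | hv
      · refine ih U hU fun x => ?_
        rw [h, LinearIsometryEquiv.coe_mul, Function.comp_apply, Submodule.reflection_orthogonal_apply,
          Submodule.reflection_singleton_apply]
        simp
      · have hn : ‖v‖ ≠ 0 := norm_ne_zero_iff.mpr hv
        set u : Fin n → ℝ := ‖v‖⁻¹ • v.ofLp with hu
        have hvv : v.ofLp ⬝ᵥ v.ofLp = ‖v‖ ^ 2 := by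
          rw [← real_inner_self_eq_norm_sq, EuclideanSpace.inner_eq_star_dotProduct]; simp
        have hu1 : u ⬝ᵥ u = 1 := by
          rw [hu, smul_dotProduct, dotProduct_smul, hvv]
          simp only [smul_eq_mul]; field_simp
        have hrefl : ∀ x : EuclideanSpace ℝ (Fin n),
            WithLp.toLp 2 ((householder u).mulVec x.ofLp) =
              (Submodule.span ℝ {v})ᗮ.reflection x := by
          intro x
          rw [Submodule.reflection_orthogonal_apply, Submodule.reflection_singleton_apply,
            householder_mulVec, EuclideanSpace.inner_eq_star_dotProduct, dotProduct_comm]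
          ext i
          simp [hu]
          field_simp
        have hmem : householder u * U ∈ orthogonalGroup (Fin n) ℝ :=
          mul_mem (householder_mem_orthogonalGroup hu1) hU
        have hU' : P (householder u * U) := by
          refine ih _ hmem fun x => ?_
          rw [← mulVec_mulVec]
          refine (hrefl (WithLp.toLp 2 (U.mulVec x.ofLp))).trans ?_
          rw [h x, LinearIsometryEquiv.coe_mul, Function.comp_apply,
            Submodule.reflection_reflection]
        have := mul u hu1 _ hmem hU'
        rwa [← mul_assoc, householder_mul_self hu1, one_mul] at this
  have hnorm : ∀ x : EuclideanSpace ℝ (Fin n), ‖WithLp.toLp 2 (U.mulVec x.ofLp)‖ = ‖x‖ := by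
    intro x
    have h : ‖WithLp.toLp 2 (U.mulVec x.ofLp)‖ ^ 2 = ‖x‖ ^ 2 := by
      rw [← real_inner_self_eq_norm_sq, ← real_inner_self_eq_norm_sq,
        EuclideanSpace.inner_eq_star_dotProduct, EuclideanSpace.inner_eq_star_dotProduct]
      simp only [star_trivial]
      rw [dotProduct_mulVec, ← mulVec_transpose, mulVec_mulVec, orthogonal_transpose_mul hU,
        one_mulVec]
    exact (sq_eq_sq₀ (norm_nonneg _) (norm_nonneg _)).mp h
  let φ₀ : EuclideanSpace ℝ (Fin n) →ₗᵢ[ℝ] EuclideanSpace ℝ (Fin n) :=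
    ⟨toLpLin 2 2 U, hnorm⟩
  obtain ⟨l, -, hl⟩ := (φ₀.toLinearIsometryEquiv rfl).reflections_generate_dim
  exact key l U hU fun x => by rw [← hl]; rfl

/-! ### Lifting orthogonal matrices through a Clifford family -/

section Clifford

variable {ι : Type*} [Fintype ι] [DecidableEq ι] {n : ℕ} {γ : Fin n → Matrix ι ι ℝ}

theorem IsCliffordFamily.polar (h : IsCliffordFamily γ) (v w : Fin n → ℝ) :
    (∑ k, v k • γ k) * (∑ k, w k • γ k) + (∑ k, w k • γ k) * (∑ k, v k • γ k) =
      (-2 * dotProduct v w) • (1 : Matrix ι ι ℝ) := by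
  have hij : ∀ i j, γ i * γ j + γ j * γ i = if i = j then (-2 : ℝ) • (1 : Matrix ι ι ℝ) else 0 := by
    intro i j
    by_cases hij : i = j
    · subst hij; rw [h.sq, if_pos rfl]; module
    · rw [h.anticomm i j hij, if_neg hij]; simp
  have h2 : (∑ k, w k • γ k) * (∑ k, v k • γ k) = ∑ i, ∑ j, (v i * w j) • (γ j * γ i) := by
    rw [Finset.sum_mul_sum, Finset.sum_comm]
    refine Finset.sum_congr rfl fun i _ => Finset.sum_congr rfl fun j _ => ?_
    rw [smul_mul_smul_comm, mul_comm]
  rw [h2, Finset.sum_mul_sum]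
  simp only [smul_mul_smul_comm, ← Finset.sum_add_distrib, ← smul_add, hij]
  simp only [smul_ite, smul_zero, Finset.sum_ite_eq, Finset.mem_univ, if_true, smul_smul,
    ← Finset.sum_smul, dotProduct, Finset.mul_sum]
  congr 1
  exact Finset.sum_congr rfl fun i _ => by ring

theorem IsCliffordFamily.sq_sum (h : IsCliffordFamily γ) {v : Fin n → ℝ}
    (hv : dotProduct v v = 1) : (∑ k, v k • γ k) * (∑ k, v k • γ k) = -1 := by
  have := h.polar v v
  rw [hv, ← two_smul ℝ] at this
  have h2 : (2 : ℝ) • ((∑ k, v k • γ k) * (∑ k, v k • γ k)) = (2 : ℝ) • (-1 : Matrix ι ι ℝ) := by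
    rw [this]; module
  exact smul_right_injective _ two_ne_zero h2

theorem IsCliffordFamily.sum_transpose (h : IsCliffordFamily γ) (v : Fin n → ℝ) :
    (∑ k, v k • γ k).transpose = -∑ k, v k • γ k := by
  simp [Matrix.transpose_sum, h.transpose]

open Matrix in
/-- Clifford multiplication by a unit vector implements minus the reflection. -/
theorem IsCliffordFamily.mul_householder (h : IsCliffordFamily γ) {v : Fin n → ℝ}
    (hv : v ⬝ᵥ v = 1) (w : Fin n → ℝ) :
    (∑ k, v k • γ k) * (∑ k, w k • γ k) =
      -((∑ k, ((householder v).mulVec w) k • γ k) * (∑ k, v k • γ k)) := by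
  have h1 : (∑ k, ((householder v).mulVec w) k • γ k) =
      (∑ k, w k • γ k) - (2 * (v ⬝ᵥ w)) • ∑ k, v k • γ k := by
    rw [householder_mulVec, Finset.smul_sum, ← Finset.sum_sub_distrib]
    refine Finset.sum_congr rfl fun k _ => ?_
    simp only [Pi.sub_apply, Pi.smul_apply, smul_eq_mul]
    module
  rw [h1, sub_mul, smul_mul_assoc, h.sq_sum hv]
  have hp := eq_sub_of_add_eq (h.polar v w)
  rw [hp]
  module

open Matrix in
/-- Lift of an orthogonal matrix to the pin group, acting through a Clifford family. -/
theorem IsCliffordFamily.exists_lift (h : IsCliffordFamily γ) {U : Matrix (Fin n) (Fin n) ℝ}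
    (hU : U ∈ orthogonalGroup (Fin n) ℝ) :
    ∃ g : Matrix ι ι ℝ, g.transpose * g = 1 ∧
      (∀ B : Matrix ι ι ℝ, (∀ i, B * γ i = γ i * B) → B * g = g * B) ∧
      (∀ B : Matrix ι ι ℝ, (∀ i, B * γ i = -(γ i * B)) → B * g = U.det • (g * B)) ∧
      ∀ w : Fin n → ℝ, g * (∑ k, w k • γ k) = U.det • ((∑ k, (U.mulVec w) k • γ k) * g) := by
  refine orthogonalGroup_induction (P := fun U => ∃ g : Matrix ι ι ℝ, g.transpose * g = 1 ∧
      (∀ B : Matrix ι ι ℝ, (∀ i, B * γ i = γ i * B) → B * g = g * B) ∧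
      (∀ B : Matrix ι ι ℝ, (∀ i, B * γ i = -(γ i * B)) → B * g = U.det • (g * B)) ∧
      ∀ w : Fin n → ℝ, g * (∑ k, w k • γ k) = U.det • ((∑ k, (U.mulVec w) k • γ k) * g))
    ⟨1, by simp⟩ ?_ hU
  -- Prepend the Clifford vector of v. Each such factor costs one sign in the last two clauses,
  -- which the determinant records.
  rintro v hv U - ⟨g, hg, hcomm, hanti, hconj⟩
  refine ⟨(∑ k, v k • γ k) * g, ?_, fun B hB => ?_, fun B hB => ?_, fun w => ?_⟩
  · rw [transpose_mul, h.sum_transpose, mul_assoc, ← mul_assoc (-_), neg_mul, h.sq_sum hv,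
      neg_neg, one_mul, hg]
  · have : B * (∑ k, v k • γ k) = (∑ k, v k • γ k) * B := by
      simp [Finset.mul_sum, Finset.sum_mul, hB]
    rw [← mul_assoc, this, mul_assoc, hcomm B hB, mul_assoc]
  · have : B * (∑ k, v k • γ k) = -((∑ k, v k • γ k) * B) := by
      simp [Finset.mul_sum, Finset.sum_mul, hB]
    rw [← mul_assoc, this, neg_mul, mul_assoc, hanti B hB, det_mul, det_householder hv, mul_assoc]
    simp
  · rw [mul_assoc, hconj, mul_smul_comm, ← mul_assoc, h.mul_householder hv, det_mul,
      det_householder hv, mulVec_mulVec, neg_mul, mul_assoc]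
    simp

end Clifford

/-! ### Maximisation over SO(n) and singular values -/

section SVD

open Matrix

theorem isCompact_specialOrthogonalGroup (n : ℕ) :
    IsCompact (specialOrthogonalGroup (Fin n) ℝ : Set (Matrix (Fin n) (Fin n) ℝ)) := by
  have hb : IsCompact (Set.pi Set.univ fun _ : Fin n => Set.pi Set.univ fun _ : Fin n =>
      Set.Icc (-1 : ℝ) 1) :=
    isCompact_univ_pi fun _ => isCompact_univ_pi fun _ => isCompact_Icc
  refine IsCompact.of_isClosed_subset hb ?_ ?_
  · have : (specialOrthogonalGroup (Fin n) ℝ : Set (Matrix (Fin n) (Fin n) ℝ)) =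
        {A | A * A.transpose = 1} ∩ {A | A.det = 1} := by
      ext A
      simp [mem_specialOrthogonalGroup_iff, mem_orthogonalGroup_iff]
    rw [this]
    refine IsClosed.inter (isClosed_eq ?_ continuous_const) (isClosed_eq ?_ continuous_const)
    · exact continuous_id.matrix_mul continuous_id.matrix_transpose
    · exact continuous_id.matrix_det
  · intro A hA i _ j _
    exact abs_le.mp (entry_norm_bound_of_unitary (mem_specialOrthogonalGroup_iff.mp hA).1 i j)

theorem continuous_frobIP {n : ℕ} (D : Matrix (Fin n) (Fin n) ℝ) :
    Continuous fun R => frobIP D R := by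
  unfold frobIP
  fun_prop

theorem exists_max_specialOrthogonalGroup {n : ℕ} (D : Matrix (Fin n) (Fin n) ℝ) :
    ∃ R ∈ specialOrthogonalGroup (Fin n) ℝ,
      ∀ S ∈ specialOrthogonalGroup (Fin n) ℝ, frobIP D S ≤ frobIP D R :=
  (isCompact_specialOrthogonalGroup n).exists_isMaxOn ⟨1, one_mem _⟩
    (continuous_frobIP D).continuousOn

theorem frobIP_vecMulVec {ι : Type*} [Fintype ι] (A : Matrix ι ι ℝ) (v w : ι → ℝ) :
    frobIP A (vecMulVec v w) = v ⬝ᵥ A *ᵥ w := by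
  rw [frobIP, mul_vecMulVec, trace_vecMulVec, mulVec_transpose, dotProduct_mulVec]

theorem frobIP_householder_mul_householder {n : ℕ} (S : Matrix (Fin n) (Fin n) ℝ)
    (u v : Fin n → ℝ) :
    frobIP S (householder u * householder v) =
      frobIP S 1 - 2 * (u ⬝ᵥ S *ᵥ u) - 2 * (v ⬝ᵥ S *ᵥ v) + 4 * (u ⬝ᵥ v) * (u ⬝ᵥ S *ᵥ v) := by
  have : householder u * householder v = 1 - (2 : ℝ) • vecMulVec u u - (2 : ℝ) • vecMulVec v v +
      (4 * (u ⬝ᵥ v)) • vecMulVec u v := by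
    rw [householder, householder, mul_sub, sub_mul, sub_mul, smul_mul_smul_comm,
      vecMulVec_mul_vecMulVec]
    simp only [one_mul, mul_one, vecMulVec_smul]
    module
  rw [this, ← frobIP_vecMulVec S u u, ← frobIP_vecMulVec S v v, ← frobIP_vecMulVec S u v]
  simp only [frobIP, mul_add, mul_sub, Matrix.mul_smul, trace_add, trace_sub, trace_smul, smul_eq_mul]

/-- If the identity maximizes `⟨S, ·⟩` over the rotations, then `S` is symmetric. -/
theorem isSymm_of_forall_frobIP_le {n : ℕ} {S : Matrix (Fin n) (Fin n) ℝ}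
    (h : ∀ R ∈ specialOrthogonalGroup (Fin n) ℝ, frobIP S R ≤ frobIP S 1) : S.IsSymm := by
  -- Test the maximality on the product of the reflections in eᵢ and in the normalised eᵢ + t eⱼ, a
  -- rotation of the (i, j)-plane.
  have main : ∀ i j, i ≠ j → ∀ t : ℝ, t * (S i j - S j i) ≤ t ^ 2 * (S i i + S j j) := by
    intro i j hij t
    set r := √(1 + t ^ 2) with hr
    have hr2 : r ^ 2 = 1 + t ^ 2 := Real.sq_sqrt (by positivity)
    have hr0 : 0 < r := Real.sqrt_pos.mpr (by positivity)
    set u : Fin n → ℝ := Pi.single i 1 with hu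
    set v : Fin n → ℝ := Pi.single i r⁻¹ + Pi.single j (t * r⁻¹) with hv
    have hu1 : u ⬝ᵥ u = 1 := by simp [hu]
    have hv1 : v ⬝ᵥ v = 1 := by
      simp [hv, hij, hij.symm]
      field_simp
      linarith
    have hmem : householder u * householder v ∈ specialOrthogonalGroup (Fin n) ℝ := by
      rw [mem_specialOrthogonalGroup_iff]
      refine ⟨mul_mem (householder_mem_orthogonalGroup hu1) (householder_mem_orthogonalGroup hv1),
        ?_⟩
      rw [det_mul, det_householder hu1, det_householder hv1]; norm_num
    have := h _ hmem
    rw [frobIP_householder_mul_householder] at this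
    have e1 : u ⬝ᵥ S *ᵥ u = S i i := by simp [hu]
    have e2 : u ⬝ᵥ S *ᵥ v = r⁻¹ * (S i i + t * S i j) := by
      simp [hu, hv, mulVec_add]; ring
    have e3 : u ⬝ᵥ v = r⁻¹ := by simp [hu, hv, hij]
    have e4 : v ⬝ᵥ S *ᵥ v =
        r⁻¹ ^ 2 * (S i i + t * (S i j + S j i) + t ^ 2 * S j j) := by
      simp [hv, mulVec_add]; ring
    rw [e1, e2, e3, e4] at this
    have h3 : 0 ≤ S i i + r⁻¹ ^ 2 * (S i i + t * (S i j + S j i) + t ^ 2 * S j j)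
        - 2 * r⁻¹ ^ 2 * (S i i + t * S i j) := by
      linarith
    have h4 : r ^ 2 * r⁻¹ ^ 2 = 1 := by field_simp
    have h5 := mul_nonneg (sq_nonneg r) h3
    have h6 : r ^ 2 * (S i i + r⁻¹ ^ 2 * (S i i + t * (S i j + S j i) + t ^ 2 * S j j)
        - 2 * r⁻¹ ^ 2 * (S i i + t * S i j)) =
        r ^ 2 * S i i + (S i i + t * (S i j + S j i) + t ^ 2 * S j j)
        - 2 * (S i i + t * S i j) := by
      linear_combination ((S i i + t * (S i j + S j i) + t ^ 2 * S j j)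
        - 2 * (S i i + t * S i j)) * h4
    rw [h6, hr2] at h5
    linarith
  ext i j
  rw [transpose_apply]
  rcases eq_or_ne i j with rfl | hij
  · rfl
  by_contra hne
  set a := S j i - S i j with ha
  have ha0 : a ≠ 0 := sub_ne_zero.mpr hne
  set b := S i i + S j j with hb
  have hp : 0 < a ^ 2 := by positivity
  have hc : (0 : ℝ) < 1 + |b| := by positivity
  -- For small t the linear term beats the quadratic one; this t forces 1 + |b| ≤ b.
  have h1 := main j i hij.symm (a / (1 + |b|))
  have h2 : (a / (1 + |b|)) * a ≤ (a / (1 + |b|)) ^ 2 * b := by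
    rw [hb, ha]; rw [add_comm (S j j)] at h1; exact h1
  have h3 : a ^ 2 * (1 + |b|) ≤ a ^ 2 * b := by
    have := mul_le_mul_of_nonneg_left h2 (sq_nonneg (1 + |b|))
    field_simp at this ⊢
    nlinarith
  have := le_of_mul_le_mul_left h3 hp
  linarith [le_abs_self b]

/-- Singular value decomposition with rotations. -/
theorem exists_svd {m : ℕ} (R : Matrix (Fin (m + 1)) (Fin (m + 1)) ℝ) :
    ∃ U ∈ specialOrthogonalGroup (Fin (m + 1)) ℝ, ∃ V ∈ specialOrthogonalGroup (Fin (m + 1)) ℝ,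
      ∃ d, R = U * diagonal d * V.transpose := by
  -- At a maximiser W, the identity maximises ⟨WᵀR, ·⟩, so WᵀR is symmetric and the spectral theorem
  -- applies. The entries of d may be negative.
  obtain ⟨W, hW, hmax⟩ := exists_max_specialOrthogonalGroup R
  have hWo := (mem_specialOrthogonalGroup_iff.mp hW).1
  have hS : (W.transpose * R).IsSymm := by
    refine isSymm_of_forall_frobIP_le fun G hG => ?_
    have := hmax (W * G) (mul_mem hW hG)
    simpa [frobIP, mul_assoc] using this
  have hH : (W.transpose * R).IsHermitian := hS
  set Q : Matrix (Fin (m + 1)) (Fin (m + 1)) ℝ := hH.eigenvectorUnitary.1 with hQ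
  have hQo : Q ∈ orthogonalGroup (Fin (m + 1)) ℝ := hH.eigenvectorUnitary.2
  have hspec : W.transpose * R = Q * diagonal hH.eigenvalues * Q.transpose := by
    have := hH.spectral_theorem
    rw [Unitary.conjStarAlgAut_apply] at this
    exact this
  have hR : R = W * (Q * diagonal hH.eigenvalues * Q.transpose) := by
    rw [← hspec, ← mul_assoc, orthogonal_mul_transpose hWo, one_mul]
  have hdet : Q.det = 1 ∨ Q.det = -1 := by
    have := congrArg det (orthogonal_mul_transpose hQo)
    rw [det_mul, det_transpose, det_one] at this
    exact mul_self_eq_one_iff.mp this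
  suffices ∃ V ∈ specialOrthogonalGroup (Fin (m + 1)) ℝ,
      Q * diagonal hH.eigenvalues * Q.transpose = V * diagonal hH.eigenvalues * V.transpose by
    obtain ⟨V, hV, he⟩ := this
    refine ⟨W * V, mul_mem hW hV, V, hV, hH.eigenvalues, ?_⟩
    rw [mul_assoc W V, mul_assoc W, ← he]
    exact hR
  rcases hdet with hd | hd
  · exact ⟨Q, mem_specialOrthogonalGroup_iff.mpr ⟨hQo, hd⟩, rfl⟩
  -- Flipping the sign of one eigenvector corrects the determinant of Q without changing the
  -- diagonalisation.
  · set e : Fin (m + 1) → ℝ := Function.update 1 0 (-1) with he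
    have hee : ∀ i, e i * e i = 1 := by
      intro i
      by_cases hi : i = 0 <;> simp [he, hi]
    have hed : (diagonal e).det = -1 := by
      rw [det_diagonal, Fin.prod_univ_succ]; simp [he]
    refine ⟨Q * diagonal e, mem_specialOrthogonalGroup_iff.mpr ⟨mul_mem hQo ?_, ?_⟩, ?_⟩
    · rw [mem_orthogonalGroup_iff, diagonal_transpose, diagonal_mul_diagonal]
      simp [hee]
    · rw [det_mul, hd, hed]; norm_num
    · have : diagonal e * diagonal hH.eigenvalues * diagonal e = diagonal hH.eigenvalues := by
        rw [diagonal_mul_diagonal, diagonal_mul_diagonal]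
        congr 1
        ext1 i
        rw [mul_comm (e i), mul_assoc, hee, mul_one]
      calc Q * diagonal hH.eigenvalues * Q.transpose
          = Q * (diagonal e * diagonal hH.eigenvalues * diagonal e) * Q.transpose := by rw [this]
        _ = _ := by rw [transpose_mul, diagonal_transpose]; simp only [mul_assoc]

end SVD

/-! ### The quadratic map on spinors and its image -/

section Spin

open Matrix

theorem dotProduct_mulVec_mulVec {ι κ : Type*} [Fintype ι] [Fintype κ] (A B : Matrix ι κ ℝ)
    (x y : κ → ℝ) : (A *ᵥ x) ⬝ᵥ (B *ᵥ y) = x ⬝ᵥ (A.transpose * B) *ᵥ y := by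
  rw [← mulVec_mulVec, dotProduct_mulVec x, vecMul_transpose]

/-- The matrix with entries `⟨λᵢ x, ρⱼ x⟩`. -/
def spinQuad {n : ℕ} (x : (Fin n → Fin 2) → ℝ) : Matrix (Fin n) (Fin n) ℝ :=
  Matrix.of fun i j => (lamMat n i *ᵥ x) ⬝ᵥ (rhoMat n j *ᵥ x)

theorem spinQuad_apply {n : ℕ} (x : (Fin n → Fin 2) → ℝ) (i j : Fin n) :
    spinQuad x i j = -(x ⬝ᵥ (lamMat n i * rhoMat n j) *ᵥ x) := by
  rw [spinQuad, of_apply, dotProduct_mulVec_mulVec, (isCliffordFamily_lamMat n).transpose, neg_mul,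
    neg_mulVec, dotProduct_neg]

theorem calA_vecMulVec (m : ℕ) (μ : (Fin m → Fin 2) → ℝ) :
    calA m (vecMulVec μ μ) = spinQuad (pEven m *ᵥ μ) := by
  ext i j
  rw [calA, of_apply, frobIP_vecMulVec, spinQuad_apply, aMat, neg_mulVec, dotProduct_neg,
    mulVec_mulVec, dotProduct_mulVec_mulVec,
    Matrix.mul_assoc, Matrix.mul_assoc, Matrix.mul_assoc]

/-- Apply the lifting relation to w = Uᵀeᵢ, which U sends back to eᵢ. -/
theorem IsCliffordFamily.lift_mul_row {ι : Type*} [Fintype ι] [DecidableEq ι] {n : ℕ}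
    {γ : Fin n → Matrix ι ι ℝ} {U : Matrix (Fin n) (Fin n) ℝ}
    (hU : U ∈ specialOrthogonalGroup (Fin n) ℝ) {g : Matrix ι ι ℝ}
    (h : ∀ w : Fin n → ℝ, g * (∑ k, w k • γ k) = U.det • ((∑ k, (U.mulVec w) k • γ k) * g))
    (i : Fin n) : γ i * g = g * ∑ k, U i k • γ k := by
  obtain ⟨hUo, hd⟩ := mem_specialOrthogonalGroup_iff.mp hU
  have h1 : U *ᵥ (U.transpose *ᵥ Pi.single i 1) = Pi.single i 1 := by
    rw [mulVec_mulVec, orthogonal_mul_transpose hUo, one_mulVec]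
  have h2 := h (U.transpose *ᵥ Pi.single i 1)
  rw [h1, hd, one_smul] at h2
  simpa [Pi.single_apply, ite_smul] using h2.symm

theorem dotProduct_mulVec_of_transpose_mul_self {ι : Type*} [Fintype ι] [DecidableEq ι]
    {g : Matrix ι ι ℝ} (hg : g.transpose * g = 1) (x y : ι → ℝ) :
    (g *ᵥ x) ⬝ᵥ (g *ᵥ y) = x ⬝ᵥ y := by
  rw [dotProduct_mulVec_mulVec, hg, one_mulVec]

/-- Left multiplication by a rotation is induced by an orthogonal map of even spinors. -/
theorem exists_spinQuad_eq_mul {n : ℕ} {U : Matrix (Fin n) (Fin n) ℝ}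
    (hU : U ∈ specialOrthogonalGroup (Fin n) ℝ) (x : (Fin n → Fin 2) → ℝ)
    (hx : chirality n *ᵥ x = x) :
    ∃ y, y ⬝ᵥ y = x ⬝ᵥ x ∧ chirality n *ᵥ y = y ∧ spinQuad y = U * spinQuad x := by
  obtain ⟨hUo, hd⟩ := mem_specialOrthogonalGroup_iff.mp hU
  obtain ⟨g, hg, hcomm, hanti, hconj⟩ := (isCliffordFamily_lamMat n).exists_lift hUo
  refine ⟨g *ᵥ x, dotProduct_mulVec_of_transpose_mul_self hg x x, ?_, ?_⟩
  · rw [mulVec_mulVec, hanti _ (chirality_mul_lamMat n), hd, one_smul, ← mulVec_mulVec, hx]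
  · ext i j
    -- The lift g commutes with ρⱼ and turns λᵢ into a combination of the λₖ with coefficients from
    -- row i of U; then g drops out by orthogonality.
    rw [spinQuad, of_apply, mulVec_mulVec, mulVec_mulVec,
      hcomm _ fun k => (lamMat_mul_rhoMat_comm n k j).symm,
      IsCliffordFamily.lift_mul_row hU hconj, ← mulVec_mulVec, ← mulVec_mulVec,
      dotProduct_mulVec_of_transpose_mul_self hg, mul_apply, sum_mulVec, sum_dotProduct]
    simp [spinQuad, smul_mulVec]

/-- Right multiplication by a rotation is induced by an orthogonal map of even spinors. -/
theorem exists_spinQuad_eq_mul_transpose {n : ℕ} {V : Matrix (Fin n) (Fin n) ℝ}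
    (hV : V ∈ specialOrthogonalGroup (Fin n) ℝ) (x : (Fin n → Fin 2) → ℝ)
    (hx : chirality n *ᵥ x = x) :
    ∃ y, y ⬝ᵥ y = x ⬝ᵥ x ∧ chirality n *ᵥ y = y ∧ spinQuad y = spinQuad x * V.transpose := by
  obtain ⟨hVo, hd⟩ := mem_specialOrthogonalGroup_iff.mp hV
  obtain ⟨g, hg, hcomm, hanti, hconj⟩ := (isCliffordFamily_rhoMat n).exists_lift hVo
  refine ⟨g *ᵥ x, dotProduct_mulVec_of_transpose_mul_self hg x x, ?_, ?_⟩
  · rw [mulVec_mulVec, hanti _ (chirality_mul_rhoMat n), hd, one_smul, ← mulVec_mulVec, hx]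
  · ext i j
    rw [spinQuad, of_apply, mulVec_mulVec, mulVec_mulVec, hcomm _ (lamMat_mul_rhoMat_comm n i),
      IsCliffordFamily.lift_mul_row hV hconj, ← mulVec_mulVec, ← mulVec_mulVec,
      dotProduct_mulVec_of_transpose_mul_self hg, mul_apply, sum_mulVec, dotProduct_sum]
    simp [spinQuad, smul_mulVec, mul_comm]

/-- On the vacuum vector ρⱼ may be replaced by λⱼ, and the Clifford relations make the λᵢe
orthonormal. -/
theorem spinQuad_single (n : ℕ) : spinQuad (Pi.single (0 : Fin n → Fin 2) (1 : ℝ)) = 1 := by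
  have h := isCliffordFamily_lamMat n
  ext i j
  rw [spinQuad, of_apply, ← lamMat_mulVec_single, dotProduct_mulVec_mulVec, h.transpose, neg_mul]
  by_cases hij : i = j
  · subst hij
    rw [h.sq, neg_neg, one_mulVec]
    simp
  · rw [one_apply_ne hij]
    set e : (Fin n → Fin 2) → ℝ := Pi.single 0 1
    have h1 : e ⬝ᵥ (-(lamMat n i * lamMat n j)) *ᵥ e = (lamMat n i *ᵥ e) ⬝ᵥ (lamMat n j *ᵥ e) := by
      rw [dotProduct_mulVec_mulVec, h.transpose, neg_mul]
    have h2 : e ⬝ᵥ (-(lamMat n i * lamMat n j)) *ᵥ e =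
        -((lamMat n j *ᵥ e) ⬝ᵥ (lamMat n i *ᵥ e)) := by
      rw [dotProduct_mulVec_mulVec, h.transpose, neg_mul, h.anticomm i j hij]
      simp [neg_mulVec]
    rw [dotProduct_comm (lamMat n j *ᵥ e), ← h1] at h2
    linarith

theorem chirality_mul_pEven (m : ℕ) : chirality (m + 1) * pEven m = pEven m := by
  have hS : chirality (m + 1) * chirality (m + 1) = 1 := by
    rw [chirality, kronProd_mul]
    simp only [sigZ_mul_sigZ, kronProd_one]
  have h1 : chirality (m + 1) * (pEven m * (pEven m).transpose) =
      pEven m * (pEven m).transpose := by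
    rw [pEven_mul_transpose, mul_smul_comm, mul_add, hS, mul_one,
      add_comm (chirality (m + 1))]
  calc chirality (m + 1) * pEven m
      = chirality (m + 1) * (pEven m * (pEven m).transpose) * pEven m := by
        rw [Matrix.mul_assoc, Matrix.mul_assoc, pEven_transpose_mul_self, Matrix.mul_one]
    _ = pEven m := by rw [h1, Matrix.mul_assoc, pEven_transpose_mul_self, Matrix.mul_one]

theorem pEven_mulVec_transpose_mulVec {m : ℕ} {x : (Fin (m + 1) → Fin 2) → ℝ}
    (hx : chirality (m + 1) *ᵥ x = x) : pEven m *ᵥ ((pEven m).transpose *ᵥ x) = x := by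
  rw [mulVec_mulVec, pEven_mul_transpose, smul_mulVec, add_mulVec, one_mulVec, hx]
  module

/-- Every rotation is of the form `𝒜 (μ μᵀ)` with a unit vector `μ`. -/
theorem exists_calA_eq_of_mem_specialOrthogonalGroup {m : ℕ}
    {R : Matrix (Fin (m + 1)) (Fin (m + 1)) ℝ}
    (hR : R ∈ specialOrthogonalGroup (Fin (m + 1)) ℝ) :
    ∃ μ : (Fin m → Fin 2) → ℝ, μ ⬝ᵥ μ = 1 ∧ R = calA m (vecMulVec μ μ) := by
  obtain ⟨y, hy1, hy2, hy3⟩ := exists_spinQuad_eq_mul hR _ (chirality_mulVec_single (m + 1))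
  refine ⟨(pEven m).transpose *ᵥ y, ?_, ?_⟩
  · rw [dotProduct_mulVec_mulVec, transpose_transpose, ← mulVec_mulVec,
      pEven_mulVec_transpose_mulVec hy2, hy1]
    simp
  · rw [calA_vecMulVec, pEven_mulVec_transpose_mulVec hy2, hy3, spinQuad_single, mul_one]

theorem spinQuad_self {n : ℕ} {x : (Fin n → Fin 2) → ℝ} (hx : chirality n *ᵥ x = x) (i : Fin n) :
    spinQuad x i i = ∑ b, x b ^ 2 * bitSign (b i) := by
  rw [spinQuad_apply, lamMat_mul_rhoMat_self, neg_mulVec, dotProduct_neg, neg_neg, ← mulVec_mulVec,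
    hx]
  simp only [dotProduct, mulVec_diagonal]
  exact Finset.sum_congr rfl fun b _ => by ring

theorem diagonal_mem_specialOrthogonalGroup {n : ℕ} {d : Fin n → ℝ} (hd : ∀ i, d i * d i = 1)
    (hp : ∏ i, d i = 1) : diagonal d ∈ specialOrthogonalGroup (Fin n) ℝ := by
  rw [mem_specialOrthogonalGroup_iff, mem_orthogonalGroup_iff, det_diagonal, diagonal_transpose,
    diagonal_mul_diagonal]
  exact ⟨by simp [hd], hp⟩

theorem transpose_mem_specialOrthogonalGroup {n : ℕ} {U : Matrix (Fin n) (Fin n) ℝ}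
    (hU : U ∈ specialOrthogonalGroup (Fin n) ℝ) :
    U.transpose ∈ specialOrthogonalGroup (Fin n) ℝ := by
  obtain ⟨h, hd⟩ := mem_specialOrthogonalGroup_iff.mp hU
  rw [mem_specialOrthogonalGroup_iff, mem_orthogonalGroup_iff, det_transpose, transpose_transpose]
  exact ⟨orthogonal_transpose_mul h, hd⟩

/-- After the SVD the spinor is replaced by an even unit spinor y with diagonal image. The squares
of its coordinates are the convex weights, and the rotations are U diag(±1) Vᵀ with signs given by
even multi-indices. -/
theorem calA_vecMulVec_mem_coSO {m : ℕ} {μ : (Fin m → Fin 2) → ℝ} (hμ : μ ⬝ᵥ μ = 1) :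
    calA m (vecMulVec μ μ) ∈ coSO (m + 1) := by
  set x := pEven m *ᵥ μ with hx
  have hx1 : x ⬝ᵥ x = 1 := by
    rw [hx, dotProduct_mulVec_mulVec, pEven_transpose_mul_self, one_mulVec, hμ]
  have hxe : chirality (m + 1) *ᵥ x = x := by rw [hx, mulVec_mulVec, chirality_mul_pEven]
  rw [calA_vecMulVec, ← hx]
  obtain ⟨U, hU, V, hV, d, hd⟩ := exists_svd (spinQuad x)
  have hUo := (mem_specialOrthogonalGroup_iff.mp hU).1
  have hVo := (mem_specialOrthogonalGroup_iff.mp hV).1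
  obtain ⟨z, hz1, hz2, hz3⟩ :=
    exists_spinQuad_eq_mul (transpose_mem_specialOrthogonalGroup hU) x hxe
  obtain ⟨y, hy1, hy2, hy3⟩ :=
    exists_spinQuad_eq_mul_transpose (transpose_mem_specialOrthogonalGroup hV) z hz2
  rw [hz3, hd, transpose_transpose] at hy3
  have hyd : spinQuad y = diagonal d := by
    rw [hy3]
    calc U.transpose * (U * diagonal d * V.transpose) * V
        = (U.transpose * U) * diagonal d * (V.transpose * V) := by simp only [mul_assoc]
      _ = diagonal d := by
        rw [orthogonal_transpose_mul hUo, orthogonal_transpose_mul hVo, one_mul, mul_one]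
  have hyy : ∑ b, y b ^ 2 = 1 := by
    rw [← hx1, ← hz1, ← hy1]
    exact Finset.sum_congr rfl fun b _ => by ring
  have hde : diagonal d = ∑ b, y b ^ 2 • diagonal fun i => bitSign (b i) := by
    ext i j
    rw [Matrix.sum_apply]
    by_cases hij : i = j
    · subst hij
      rw [← hyd, spinQuad_self hy2]
      simp
    · simp [hij]
  have hpar : ∀ b, y b ≠ 0 → ∏ k, bitSign (b k) = 1 := by
    intro b hb
    have := congrFun hy2 b
    rw [chirality_eq_diagonal, mulVec_diagonal] at this
    exact mul_right_cancel₀ hb (by rw [this, one_mul])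
  -- Odd b have weight zero; the identity is an arbitrary rotation filling their terms.
  have hR : spinQuad x = ∑ b, y b ^ 2 •
      (if ∏ k, bitSign (b k) = 1 then U * (diagonal fun i => bitSign (b i)) * V.transpose
        else 1) := by
    rw [hd, hde, Finset.mul_sum, Finset.sum_mul]
    refine Finset.sum_congr rfl fun b _ => ?_
    by_cases hb : y b = 0
    · simp [hb]
    · rw [if_pos (hpar b hb), mul_smul_comm, smul_mul_assoc]
  rw [hR]
  refine (convex_convexHull ℝ _).sum_mem (fun b _ => sq_nonneg _) hyy fun b _ => ?_
  refine subset_convexHull ℝ _ ?_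
  rw [SetLike.mem_coe]
  split_ifs with hb
  · exact mul_mem (mul_mem hU (diagonal_mem_specialOrthogonalGroup
      (fun i => bitSign_mul_self _) hb)) (transpose_mem_specialOrthogonalGroup hV)
  · exact one_mem _

/-! ### Adjointness, Rayleigh quotients and convexity -/

theorem frobIP_eq_sum {ι κ : Type*} [Fintype ι] [Fintype κ] (A B : Matrix ι κ ℝ) :
    frobIP A B = ∑ i, ∑ j, A i j * B i j := by
  rw [Finset.sum_comm]
  simp [frobIP, trace, mul_apply]

theorem frobIP_comm {ι κ : Type*} [Fintype ι] [Fintype κ] (A B : Matrix ι κ ℝ) :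
    frobIP A B = frobIP B A := by
  simp only [frobIP_eq_sum, mul_comm]

theorem frobIP_calA (m : ℕ) (Z : Matrix (Fin m → Fin 2) (Fin m → Fin 2) ℝ)
    (D : Matrix (Fin (m + 1)) (Fin (m + 1)) ℝ) :
    frobIP (calA m Z) D = frobIP Z (calAdj m D) := by
  rw [frobIP_comm Z, frobIP_eq_sum]
  simp only [frobIP, calAdj, calA, of_apply, transpose_sum, transpose_smul, Finset.sum_mul,
    trace_sum, smul_mul_assoc, trace_smul, smul_eq_mul, mul_comm]

theorem calAdj_isSymm (m : ℕ) (D : Matrix (Fin (m + 1)) (Fin (m + 1)) ℝ) :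
    (calAdj m D).IsSymm := by
  have h : ∀ i j, (aMat m i j).transpose = aMat m i j := by
    intro i j
    rw [aMat, transpose_neg, transpose_mul, transpose_mul, transpose_mul, transpose_transpose,
      (isCliffordFamily_lamMat _).transpose, (isCliffordFamily_rhoMat _).transpose,
      Matrix.mul_assoc (pEven m).transpose, lamMat_mul_rhoMat_comm]
    simp [Matrix.mul_assoc]
  simp [IsSymm, calAdj, transpose_sum, h]

theorem dotProduct_calAdj_mulVec (m : ℕ) (D : Matrix (Fin (m + 1)) (Fin (m + 1)) ℝ)
    (μ : (Fin m → Fin 2) → ℝ) :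
    μ ⬝ᵥ calAdj m D *ᵥ μ = frobIP D (calA m (vecMulVec μ μ)) := by
  rw [frobIP_comm, frobIP_calA, frobIP_comm, frobIP_vecMulVec]

/-- Carries uniqueness of a maximiser from SO(n) to its convex hull: once this set contains SO(n),
it contains the hull. -/
theorem convex_setOf_frobIP_lt_or_eq {n : ℕ} (D R : Matrix (Fin n) (Fin n) ℝ) :
    Convex ℝ {S | frobIP D S < frobIP D R ∨ S = R} := by
  have hlin : ∀ (a b : ℝ) (S T : Matrix (Fin n) (Fin n) ℝ),
      frobIP D (a • S + b • T) = a * frobIP D S + b * frobIP D T := by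
    intro a b S T; simp [frobIP, mul_add]
  rw [convex_iff_forall_pos]
  rintro S hS T hT a b ha hb hab
  rw [Set.mem_ofPred_eq, hlin]
  rcases hS with hS | rfl <;> rcases hT with hT | rfl
  · left
    calc a * frobIP D S + b * frobIP D T < a * frobIP D R + b * frobIP D R := by gcongr
      _ = frobIP D R := by rw [← add_mul, hab, one_mul]
  · left
    calc a * frobIP D S + b * frobIP D T < a * frobIP D T + b * frobIP D T := by gcongr
      _ = frobIP D T := by rw [← add_mul, hab, one_mul]
  · left
    calc a * frobIP D S + b * frobIP D T < a * frobIP D S + b * frobIP D S := by gcongr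
      _ = frobIP D S := by rw [← add_mul, hab, one_mul]
  · right; rw [← add_smul, hab, one_smul]

theorem frobIP_le_of_mem_coSO {n : ℕ} {D : Matrix (Fin n) (Fin n) ℝ} {c : ℝ}
    (h : ∀ S ∈ specialOrthogonalGroup (Fin n) ℝ, frobIP D S ≤ c) {S : Matrix (Fin n) (Fin n) ℝ}
    (hS : S ∈ coSO n) : frobIP D S ≤ c := by
  refine convexHull_min (t := {S | frobIP D S ≤ c}) h ?_ hS
  have : IsLinearMap ℝ fun S => frobIP D S :=
    ⟨fun A B => by simp [frobIP, mul_add], fun a A => by simp [frobIP]⟩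
  exact convex_halfSpace_le this c

/-- A vector attaining the maximum of the Rayleigh quotient is an eigenvector. -/
theorem mulVec_eq_smul_of_rayleigh_max {ι : Type*} [Fintype ι] [DecidableEq ι] {M : Matrix ι ι ℝ}
    (hM : M.IsSymm) {ν : ℝ} (h : ∀ v : ι → ℝ, v ⬝ᵥ v = 1 → v ⬝ᵥ M *ᵥ v ≤ ν) {μ : ι → ℝ}
    (hμ1 : μ ⬝ᵥ μ = 1) (hμ : μ ⬝ᵥ M *ᵥ μ = ν) : M *ᵥ μ = ν • μ := by
  -- A positive semidefinite form vanishes only on its kernel, and this one vanishes at μ.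
  have hpsd : (ν • (1 : Matrix ι ι ℝ) - M).PosSemidef := by
    refine PosSemidef.of_dotProduct_mulVec_nonneg ?_ fun x => ?_
    · have : (ν • (1 : Matrix ι ι ℝ) - M).transpose = ν • (1 : Matrix ι ι ℝ) - M := by
        simp [hM.eq]
      exact this
    · rw [star_trivial, sub_mulVec, smul_mulVec, one_mulVec, dotProduct_sub, dotProduct_smul,
        smul_eq_mul]
      rcases eq_or_ne x 0 with rfl | hx
      · simp
      have hpos : 0 < x ⬝ᵥ x := by
        have := dotProduct_star_self_pos_iff.mpr hx
        simpa using this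
      set r := √(x ⬝ᵥ x)
      have hr2 : r * r = x ⬝ᵥ x := Real.mul_self_sqrt hpos.le
      have hr : 0 < r := Real.sqrt_pos.mpr hpos
      have h1 := h (r⁻¹ • x) (by
        rw [smul_dotProduct, dotProduct_smul, ← hr2, smul_eq_mul, smul_eq_mul]; field_simp)
      rw [mulVec_smul, smul_dotProduct, dotProduct_smul, smul_eq_mul, smul_eq_mul] at h1
      have h2 := mul_le_mul_of_nonneg_left h1 hpos.le
      rw [← hr2] at h2 ⊢
      have h3 : r * r * (r⁻¹ * (r⁻¹ * x ⬝ᵥ M *ᵥ x)) = x ⬝ᵥ M *ᵥ x := by field_simp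
      rw [h3] at h2
      linarith
  have h0 := (hpsd.dotProduct_mulVec_zero_iff μ).mp (by
    rw [star_trivial, sub_mulVec, smul_mulVec, one_mulVec, dotProduct_sub, dotProduct_smul,
      smul_eq_mul, hμ1, hμ]; ring)
  rw [sub_mulVec, smul_mulVec, one_mulVec, sub_eq_zero] at h0
  exact h0.symm

end Spin

/-! ### Explicit formulas for n ≤ 3 -/

section LowDimension

open Matrix

theorem sum_fin_zero_to_fin_two (f : (Fin 0 → Fin 2) → ℝ) : ∑ x, f x = f ![] :=
  Fintype.sum_subsingleton f ![]

theorem sum_fin_succ_to_fin_two {n : ℕ} (f : (Fin (n + 1) → Fin 2) → ℝ) :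
    ∑ x, f x = ∑ t : Fin n → Fin 2, f (vecCons 0 t) + ∑ t : Fin n → Fin 2, f (vecCons 1 t) := by
  rw [← (Fin.consEquiv fun _ => Fin 2).sum_comp, Fintype.sum_prod_type, Fin.sum_univ_two]
  rfl

theorem kronProd_vecCons {n : ℕ} (M : Fin (n + 1) → Matrix (Fin 2) (Fin 2) ℝ) (a b : Fin 2)
    (s t : Fin n → Fin 2) :
    kronProd M (vecCons a s) (vecCons b t) = M 0 a b * kronProd (fun k => M k.succ) s t := by
  simp [kronProd, Fin.prod_univ_succ]

theorem kronProd_empty (M : Fin 0 → Matrix (Fin 2) (Fin 2) ℝ) (s t : Fin 0 → Fin 2) :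
    kronProd M s t = 1 := by
  simp [kronProd]

theorem pEven_mulVec_apply (m : ℕ) (μ : (Fin m → Fin 2) → ℝ) (a : Fin 2) (t : Fin m → Fin 2) :
    (pEven m *ᵥ μ) (vecCons a t) = (1 + bitSign a * ∏ k, bitSign (t k)) / 2 * μ t := by
  rw [mulVec, dotProduct, Finset.sum_eq_single t]
  · simp [pEven_apply, Fin.prod_univ_succ, vecCons]
  · intro b _ hb
    simp [pEven_apply, vecCons, hb.symm]
  · simp

theorem mulVec_eq_add {n : ℕ} {κ : Type*} (A : Matrix κ (Fin (n + 1) → Fin 2) ℝ)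
    (x : (Fin (n + 1) → Fin 2) → ℝ) (s : κ) :
    (A *ᵥ x) s = ∑ t : Fin n → Fin 2, A s (vecCons 0 t) * x (vecCons 0 t) +
      ∑ t : Fin n → Fin 2, A s (vecCons 1 t) * x (vecCons 1 t) :=
  sum_fin_succ_to_fin_two fun t => A s t * x t

theorem calA_zero (μ : (Fin 0 → Fin 2) → ℝ) : calA 0 (vecMulVec μ μ) = !![μ ![] ^ 2] := by
  rw [calA_vecMulVec]
  ext i j
  fin_cases i; fin_cases j
  simp [spinQuad, lamMat, rhoMat, dotProduct, sum_fin_succ_to_fin_two, mulVec_eq_add,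
    kronProd_vecCons, kronProd_empty, pEven_mulVec_apply, rotJ, bitSign, sq,
    sum_fin_zero_to_fin_two, -Finset.univ_unique]

/-- For μ = (cos θ, sin θ) this is the rotation by 2θ. -/
theorem calA_one (μ : (Fin 1 → Fin 2) → ℝ) :
    calA 1 (vecMulVec μ μ) =
      !![μ ![0] ^ 2 - μ ![1] ^ 2, -2 * μ ![0] * μ ![1];
        2 * μ ![0] * μ ![1], μ ![0] ^ 2 - μ ![1] ^ 2] := by
  rw [calA_vecMulVec]
  have h00 := pEven_mulVec_apply 1 μ 0 ![0]
  have h01 := pEven_mulVec_apply 1 μ 0 ![1]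
  have h10 := pEven_mulVec_apply 1 μ 1 ![0]
  have h11 := pEven_mulVec_apply 1 μ 1 ![1]
  simp [bitSign] at h00 h01 h10 h11
  generalize pEven 1 *ᵥ μ = x at *
  ext i j
  fin_cases i <;> fin_cases j <;>
  · simp [spinQuad, lamMat, rhoMat, dotProduct, sum_fin_succ_to_fin_two, mulVec_eq_add,
      kronProd_vecCons, kronProd_empty, rotJ, sigZ, h00, h01, h10, h11,
      sum_fin_zero_to_fin_two, -Finset.univ_unique]
    try ring

-- The Euler–Rodrigues matrix of the quaternion μ₀₀ + μ₁₁ i − μ₀₁ j + μ₁₀ k.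
set_option maxHeartbeats 1000000 in
theorem calA_two (μ : (Fin 2 → Fin 2) → ℝ) :
    calA 2 (vecMulVec μ μ) =
      !![μ ![0, 0] ^ 2 + μ ![1, 1] ^ 2 - μ ![0, 1] ^ 2 - μ ![1, 0] ^ 2,
          -2 * μ ![0, 0] * μ ![1, 0] - 2 * μ ![1, 1] * μ ![0, 1],
          -2 * μ ![0, 0] * μ ![0, 1] + 2 * μ ![1, 1] * μ ![1, 0];
        2 * μ ![0, 0] * μ ![1, 0] - 2 * μ ![1, 1] * μ ![0, 1],
          μ ![0, 0] ^ 2 - μ ![1, 1] ^ 2 + μ ![0, 1] ^ 2 - μ ![1, 0] ^ 2,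
          -2 * μ ![0, 0] * μ ![1, 1] - 2 * μ ![0, 1] * μ ![1, 0];
        2 * μ ![0, 0] * μ ![0, 1] + 2 * μ ![1, 1] * μ ![1, 0],
          2 * μ ![0, 0] * μ ![1, 1] - 2 * μ ![0, 1] * μ ![1, 0],
          μ ![0, 0] ^ 2 - μ ![1, 1] ^ 2 - μ ![0, 1] ^ 2 + μ ![1, 0] ^ 2] := by
  rw [calA_vecMulVec]
  have h000 := pEven_mulVec_apply 2 μ 0 ![0, 0]
  have h001 := pEven_mulVec_apply 2 μ 0 ![0, 1]
  have h010 := pEven_mulVec_apply 2 μ 0 ![1, 0]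
  have h011 := pEven_mulVec_apply 2 μ 0 ![1, 1]
  have h100 := pEven_mulVec_apply 2 μ 1 ![0, 0]
  have h101 := pEven_mulVec_apply 2 μ 1 ![0, 1]
  have h110 := pEven_mulVec_apply 2 μ 1 ![1, 0]
  have h111 := pEven_mulVec_apply 2 μ 1 ![1, 1]
  simp [bitSign] at h000 h001 h010 h011 h100 h101 h110 h111
  generalize pEven 2 *ᵥ μ = x at *
  ext i j
  fin_cases i <;> fin_cases j <;>
  · simp [spinQuad, lamMat, rhoMat, dotProduct, sum_fin_succ_to_fin_two, mulVec_eq_add,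
      kronProd_vecCons, kronProd_empty, rotJ, sigZ, h000, h001, h010, h011, h100, h101, h110, h111,
      sum_fin_zero_to_fin_two, -Finset.univ_unique]
    try ring

theorem calA_vecMulVec_mem_of_le_three {m : ℕ} (hm : m + 1 ≤ 3) {μ : (Fin m → Fin 2) → ℝ}
    (hμ : μ ⬝ᵥ μ = 1) :
    calA m (vecMulVec μ μ) ∈ specialOrthogonalGroup (Fin (m + 1)) ℝ := by
  rw [mem_specialOrthogonalGroup_iff, mem_orthogonalGroup_iff]
  have hm : m = 0 ∨ m = 1 ∨ m = 2 := by omega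
  rcases hm with rfl | rfl | rfl
  · have hs : μ ![] * μ ![] = 1 := by
      rw [← hμ]
      simp [dotProduct, sum_fin_zero_to_fin_two, -Finset.univ_unique]
    rw [calA_zero, sq, hs]
    refine ⟨?_, by simp⟩
    ext i j
    fin_cases i; fin_cases j
    simp [mul_apply]
  · have hs : μ ![0] ^ 2 + μ ![1] ^ 2 = 1 := by
      rw [← hμ]
      simp [dotProduct, sum_fin_succ_to_fin_two, sq,
        sum_fin_zero_to_fin_two, -Finset.univ_unique]
    rw [calA_one]
    generalize μ ![0] = a at *
    generalize μ ![1] = b at *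
    constructor
    · ext i j
      fin_cases i <;> fin_cases j <;> simp [mul_apply, Fin.sum_univ_succ]
      -- With s the sum of squares, R Rᵀ = s² I, and s² − 1 = (s + 1)(s − 1).
      · linear_combination (a ^ 2 + b ^ 2 + 1) * hs
      · ring
      · ring
      · linear_combination (a ^ 2 + b ^ 2 + 1) * hs
    · rw [det_fin_two_of]
      linear_combination (a ^ 2 + b ^ 2 + 1) * hs
  · have hs : μ ![0, 0] ^ 2 + μ ![1, 1] ^ 2 + μ ![0, 1] ^ 2 + μ ![1, 0] ^ 2 = 1 := by
      rw [← hμ]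
      simp [dotProduct, sum_fin_succ_to_fin_two,
        sum_fin_zero_to_fin_two, -Finset.univ_unique]
      ring
    rw [calA_two]
    generalize μ ![0, 0] = a at *
    generalize μ ![1, 1] = b at *
    generalize μ ![0, 1] = c at *
    generalize μ ![1, 0] = d at *
    constructor
    · ext i j
      fin_cases i <;> fin_cases j <;> simp [mul_apply, Fin.sum_univ_succ]
      · linear_combination (a ^ 2 + b ^ 2 + c ^ 2 + d ^ 2 + 1) * hs
      · ring
      · ring
      · ring
      · linear_combination (a ^ 2 + b ^ 2 + c ^ 2 + d ^ 2 + 1) * hs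
      · ring
      · ring
      · ring
      · linear_combination (a ^ 2 + b ^ 2 + c ^ 2 + d ^ 2 + 1) * hs
    · rw [det_fin_three]
      simp
      -- Here the determinant is s³, and s³ − 1 = (s² + s + 1)(s − 1).
      linear_combination ((a ^ 2 + b ^ 2 + c ^ 2 + d ^ 2) ^ 2 +
        (a ^ 2 + b ^ 2 + c ^ 2 + d ^ 2) + 1) * hs

end LowDimension

/-! ### The main theorem -/

theorem lemma2 (m : ℕ) (D : Matrix (Fin (m + 1)) (Fin (m + 1)) ℝ) :
    -- `𝒜† D` is symmetric, and `𝒜†` is the adjoint of `𝒜` on symmetric matrices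
    (calAdj m D).IsSymm ∧
    (∀ Z : Matrix (Fin m → Fin 2) (Fin m → Fin 2) ℝ, Z.IsSymm →
      frobIP (calA m Z) D = frobIP Z (calAdj m D)) ∧
    ∃ ν : ℝ, IsLargestEigenvalue (calAdj m D) ν ∧
      -- every unit eigenvector for the largest eigenvalue gives an optimal solution
      (∀ μ : (Fin m → Fin 2) → ℝ, IsUnitEigenvector (calAdj m D) ν μ →
        IsOptimal D (calA m (Matrix.vecMulVec μ μ))) ∧
      -- if the largest eigenvalue is simple, this is the only one, and it is a rotation
      (Module.finrank ℝ (Module.End.eigenspace (Matrix.toLin' (calAdj m D)) ν) = 1 →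
        ∀ μ : (Fin m → Fin 2) → ℝ, IsUnitEigenvector (calAdj m D) ν μ →
          calA m (Matrix.vecMulVec μ μ) ∈ Matrix.specialOrthogonalGroup (Fin (m + 1)) ℝ ∧
          ∀ R, IsOptimal D R → R = calA m (Matrix.vecMulVec μ μ)) ∧
      -- if `n = m + 1 ≤ 3`, it is a rotation whatever the multiplicity
      (m + 1 ≤ 3 → ∀ μ : (Fin m → Fin 2) → ℝ, IsUnitEigenvector (calAdj m D) ν μ →
        calA m (Matrix.vecMulVec μ μ) ∈ Matrix.specialOrthogonalGroup (Fin (m + 1)) ℝ) ∧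
      -- in general some unit eigenvector gives an optimal solution that is a rotation
      (∃ μ : (Fin m → Fin 2) → ℝ, IsUnitEigenvector (calAdj m D) ν μ ∧
        calA m (Matrix.vecMulVec μ μ) ∈ Matrix.specialOrthogonalGroup (Fin (m + 1)) ℝ) ∧
      -- and every optimal solution that is a rotation arises in this way
      (∀ R ∈ Matrix.specialOrthogonalGroup (Fin (m + 1)) ℝ, IsOptimal D R →
        ∃ μ : (Fin m → Fin 2) → ℝ, IsUnitEigenvector (calAdj m D) ν μ ∧
          R = calA m (Matrix.vecMulVec μ μ)) := by
  obtain ⟨R₀, hR₀, hmax⟩ := exists_max_specialOrthogonalGroup D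
  -- ν is introduced as the optimal value over SO(n); that it is the largest eigenvalue is shown
  -- afterwards.
  set ν := frobIP D R₀ with hν
  have hsymm := calAdj_isSymm m D
  have hco : ∀ S ∈ coSO (m + 1), frobIP D S ≤ ν := fun S hS => frobIP_le_of_mem_coSO hmax hS
  have hle : ∀ v : (Fin m → Fin 2) → ℝ, dotProduct v v = 1 →
      dotProduct v ((calAdj m D).mulVec v) ≤ ν := fun v hv => by
    rw [dotProduct_calAdj_mulVec]
    exact hco _ (calA_vecMulVec_mem_coSO hv)
  have hval : ∀ μ : (Fin m → Fin 2) → ℝ, IsUnitEigenvector (calAdj m D) ν μ →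
      frobIP D (calA m (Matrix.vecMulVec μ μ)) = ν := fun μ hμ => by
    rw [← dotProduct_calAdj_mulVec, hμ.1, dotProduct_smul, hμ.2, smul_eq_mul, mul_one]
  -- A unit spinor over an optimal rotation attains the Rayleigh bound `hle`, hence is an
  -- eigenvector.
  have hlift : ∀ R ∈ Matrix.specialOrthogonalGroup (Fin (m + 1)) ℝ, frobIP D R = ν →
      ∃ μ : (Fin m → Fin 2) → ℝ, IsUnitEigenvector (calAdj m D) ν μ ∧
        R = calA m (Matrix.vecMulVec μ μ) := fun R hR hRν => by
    obtain ⟨μ, hμ, rfl⟩ := exists_calA_eq_of_mem_specialOrthogonalGroup hR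
    refine ⟨μ, ⟨mulVec_eq_smul_of_rayleigh_max hsymm hle hμ ?_, hμ⟩, rfl⟩
    rw [dotProduct_calAdj_mulVec, hRν]
  have hopt : ∀ R, IsOptimal D R → frobIP D R = ν := fun R hR =>
    le_antisymm (hco R hR.1) (hR.2 R₀ (subset_convexHull ℝ _ hR₀))
  obtain ⟨μ₀, hμ₀, hR₀μ⟩ := hlift R₀ hR₀ rfl
  have hne : ∀ μ : (Fin m → Fin 2) → ℝ, dotProduct μ μ = 1 → μ ≠ 0 := by
    rintro μ hμ rfl
    simp at hμ
  refine ⟨hsymm, fun Z _ => frobIP_calA m Z D, ν, ⟨?_, ?_⟩, fun μ hμ => ?_, fun hfin μ hμ => ?_,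
    fun hm μ hμ => calA_vecMulVec_mem_of_le_three hm hμ.2, ⟨μ₀, hμ₀, hR₀μ ▸ hR₀⟩,
    fun R hR hRo => hlift R hR (hopt R hRo)⟩
  · refine Module.End.hasEigenvalue_of_hasEigenvector (x := μ₀)
      ⟨Module.End.mem_eigenspace_iff.mpr ?_, hne μ₀ hμ₀.2⟩
    rw [Matrix.toLin'_apply, hμ₀.1]
  · intro c hc
    obtain ⟨v, hv, hv0⟩ := Module.End.HasEigenvalue.exists_hasEigenvector hc
    rw [Module.End.mem_eigenspace_iff, Matrix.toLin'_apply] at hv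
    have hpos : 0 < dotProduct v v := by
      simpa using Matrix.dotProduct_star_self_pos_iff.mpr hv0
    have hr2 : √(dotProduct v v) * √(dotProduct v v) = dotProduct v v :=
      Real.mul_self_sqrt hpos.le
    have hr := Real.sqrt_pos.mpr hpos
    have hunit : dotProduct ((√(dotProduct v v))⁻¹ • v) ((√(dotProduct v v))⁻¹ • v) = 1 := by
      rw [smul_dotProduct, dotProduct_smul, smul_eq_mul, smul_eq_mul]
      nth_rewrite 3 [← hr2]
      field_simp
    have := hle _ hunit
    rwa [Matrix.mulVec_smul, hv, smul_comm, dotProduct_smul, hunit, smul_eq_mul, mul_one] at this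
  · refine ⟨calA_vecMulVec_mem_coSO hμ.2, fun S hS => ?_⟩
    rw [hval μ hμ]
    exact hco S hS
  -- Unit vectors on a line differ by a sign, which μμᵀ does not see.
  · have huniq : ∀ μ' : (Fin m → Fin 2) → ℝ, IsUnitEigenvector (calAdj m D) ν μ' →
        calA m (Matrix.vecMulVec μ' μ') = calA m (Matrix.vecMulVec μ μ) := by
      intro μ' hμ'
      have hmem : ∀ x : (Fin m → Fin 2) → ℝ, IsUnitEigenvector (calAdj m D) ν x →
          x ∈ Module.End.eigenspace (Matrix.toLin' (calAdj m D)) ν := fun x hx => by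
        rw [Module.End.mem_eigenspace_iff, Matrix.toLin'_apply, hx.1]
      have hne' : (⟨μ, hmem μ hμ⟩ : Module.End.eigenspace (Matrix.toLin' (calAdj m D)) ν) ≠ 0 :=
        fun h => hne μ hμ.2 (congrArg Subtype.val h)
      obtain ⟨c, hc⟩ := (finrank_eq_one_iff_of_nonzero' _ hne').mp hfin ⟨μ', hmem μ' hμ'⟩
      have hc' : c • μ = μ' := congrArg Subtype.val hc
      have hcc : c * c = 1 := by
        have := hμ'.2
        rwa [← hc', smul_dotProduct, dotProduct_smul, hμ.2, smul_eq_mul, smul_eq_mul,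
          mul_one] at this
      rw [← hc', Matrix.smul_vecMulVec, Matrix.vecMulVec_smul, smul_smul, hcc, one_smul]
    refine ⟨by rw [← huniq μ₀ hμ₀, ← hR₀μ]; exact hR₀, fun R hR => ?_⟩
    have hsub : coSO (m + 1) ⊆ {S | frobIP D S < frobIP D (calA m (Matrix.vecMulVec μ μ)) ∨
        S = calA m (Matrix.vecMulVec μ μ)} := by
      refine convexHull_min (fun S hS => ?_) (convex_setOf_frobIP_lt_or_eq D _)
      rcases (hmax S hS).lt_or_eq with h | h
      · left
        rw [hval μ hμ]
        exact h
      · right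
        obtain ⟨μ', hμ', rfl⟩ := hlift S hS h
        exact huniq μ' hμ'
    rcases hsub hR.1 with h | h
    · rw [hval μ hμ, hopt R hR] at h
      exact absurd h (lt_irrefl _)
    · exact h
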